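/- Let $\mathcal G$ be a graph of groups on a finite simply connected graph (that is, a finite tree) whose vertex groups are finitely generated, and let $G=\pi_1(\mathcal G)$ be its fundamental group. The vertex subgroups and edge subgroups of $G$ are the images in $G$ of the vertex groups and of the edge groups. Then $G$ is finitely generated, and the following holds. Let $H$ be a finitely generated normal subgroup of $G$ that is not contained in any edge subgroup and such that $A\cap H$ is finitely generated for every vertex subgroup $A$ of $G$. Then $$\mathrm{Dist}_G^H(n)\ \preceq\ n\cdot\max\{\mathrm{Dist}_A^{A\cap H}(n) : A \text{ a vertex subgroup of } G\}.$$ Here, for a group $K$ with a finite generating set $S$ and a subgroup $L\le K$ with a finite generating set $T$, the distortion of $L$ in $K$ is $\mathrm{Dist}_K^L(r)=\max\{|h|_T : h\in L,\ |h|_S\le r\}$, where $|\cdot|_S$ and $|\cdot|_T$ are the word lengths; the statement holds for every choice of the finite generating sets of $G$, of $H$, of the vertex subgroups $A$ and of the subgroups $A\cap H$. For functions $f,g:[0,\infty)\to[0,\infty]$ we write $f\preceq g$ if there are positive constants $a,b,c,d$ such that $f(x)\le a\,g(bx)+cx$ for all $x>d$. -/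

import Mathlib

open scoped NNReal ENNReal

universe u v w

/-! ### Domination of functions, word length, subgroup distortion -/

/-- `f ≼ g` for functions from `[0, ∞)` to `[0, ∞]`: there are positive constants `A, B, C, D` with
`f x ≤ A * g (B * x) + C * x` for all `x > D`. -/
def Dominated (f g : ℝ≥0 → ℝ≥0∞) : Prop :=
  ∃ A B C D : ℝ≥0, 0 < A ∧ 0 < B ∧ 0 < C ∧ 0 < D ∧
    ∀ x : ℝ≥0, D < x → f x ≤ (A : ℝ≥0∞) * g (B * x) + (C : ℝ≥0∞) * (x : ℝ≥0∞)

/-- The word length `|g|_S`: the least length of a word in the letters `S ∪ S⁻¹` representing `g`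
(it is `⊤` if `g` is not in the subgroup generated by `S`). -/
noncomputable def wordLength {G : Type*} [Group G] (S : Set G) (g : G) : ℕ∞ :=
  ⨅ (l : List G) (_ : (∀ x ∈ l, x ∈ S ∨ x⁻¹ ∈ S) ∧ l.prod = g), (l.length : ℕ∞)

/-- The distortion of the subgroup `H` in `G` with respect to the generating sets `S` of `G` and `T`
of `H`: the function `r ↦ max {|h|_T : h ∈ H, |h|_S ≤ r}`. -/
noncomputable def distortion {G : Type*} [Group G] (S : Set G) (H : Subgroup G) (T : Set H)
    (r : ℝ≥0) : ℝ≥0∞ :=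
  ⨆ (h : H) (_ : (wordLength S (h : G) : ℝ≥0∞) ≤ (r : ℝ≥0∞)), (wordLength T h : ℝ≥0∞)

/-! ### Simply connected graphs -/

/-- A graph (loops and multiple edges allowed, with an arbitrary choice of orientation of its edges,
that is, a quiver) is simply connected if it is nonempty, any two vertices are joined by an edge
path, and any two edge paths with the same endpoints are homotopic. The morphisms of the free
groupoid on a quiver are the homotopy classes of edge paths; these run through the edges in either
direction. -/
def IsSimplyConnectedGraph (V : Type u) [Quiver.{v} V] : Prop :=
  Nonempty V ∧ ∀ a b : V,
    Nonempty (Unique ((Quiver.FreeGroupoid.of V).obj a ⟶ (Quiver.FreeGroupoid.of V).obj b))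

/-! ### Graphs of groups -/

/-- A graph of groups on the graph `V`: a group for every vertex, a group for every edge, and
injective homomorphisms from each edge group to the vertex groups at the two ends of the edge. -/
structure GraphOfGroups (V : Type u) [Quiver.{v} V] where
  vertexGroup : V → Type w
  [vertexInst : ∀ a, Group (vertexGroup a)]
  edgeGroup : ∀ {a b : V}, (a ⟶ b) → Type w
  [edgeInst : ∀ {a b : V} (e : a ⟶ b), Group (edgeGroup e)]
  toSource : ∀ {a b : V} (e : a ⟶ b), edgeGroup e →* vertexGroup a
  toTarget : ∀ {a b : V} (e : a ⟶ b), edgeGroup e →* vertexGroup b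
  toSource_injective : ∀ {a b : V} (e : a ⟶ b), Function.Injective (toSource e)
  toTarget_injective : ∀ {a b : V} (e : a ⟶ b), Function.Injective (toTarget e)

namespace GraphOfGroups

attribute [instance] GraphOfGroups.vertexInst GraphOfGroups.edgeInst

variable {V : Type u} [Quiver.{v} V] (𝒢 : GraphOfGroups.{u, v, w} V)

/-- The free product of all vertex groups and of the free group on the set of edges. -/
abbrev PathGroup : Type (max u v w) :=
  Monoid.Coprod (Monoid.CoprodI 𝒢.vertexGroup) (FreeGroup (Quiver.Total V))

/-- The inclusion of a vertex group in the free product. -/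
def vertexIncl (a : V) : 𝒢.vertexGroup a →* 𝒢.PathGroup :=
  Monoid.Coprod.inl.comp Monoid.CoprodI.of

/-- The stable letter of an edge. -/
def stableLetter {a b : V} (e : a ⟶ b) : 𝒢.PathGroup :=
  Monoid.Coprod.inr (FreeGroup.of (Quiver.Total.mk a b e))

/-- The relators of the fundamental group relative to a set `T` of edges (a maximal subtree):
`t_e * c_target * t_e⁻¹ = c_source` for every edge `e` and every `c` in the edge group of `e`, and
`t_e = 1` for every edge `e` in `T`. -/
def relators (T : WideSubquiver V) : Set 𝒢.PathGroup :=
  {x | ∃ (a b : V) (e : a ⟶ b) (c : 𝒢.edgeGroup e),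
      x = 𝒢.stableLetter e * 𝒢.vertexIncl b (𝒢.toTarget e c) * (𝒢.stableLetter e)⁻¹ *
        (𝒢.vertexIncl a (𝒢.toSource e c))⁻¹} ∪
  {x | ∃ (a b : V) (e : a ⟶ b), e ∈ T a b ∧ x = 𝒢.stableLetter e}

/-- The fundamental group `π₁(𝒢, T)` of a graph of groups relative to a maximal subtree `T` of the
underlying graph. -/
abbrev FundamentalGroup (T : WideSubquiver V) : Type (max u v w) :=
  𝒢.PathGroup ⧸ Subgroup.normalClosure (𝒢.relators T)

/-- The canonical homomorphism from a vertex group to the fundamental group. -/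
def vertexHom (T : WideSubquiver V) (a : V) : 𝒢.vertexGroup a →* 𝒢.FundamentalGroup T :=
  (QuotientGroup.mk' (Subgroup.normalClosure (𝒢.relators T))).comp (𝒢.vertexIncl a)

/-- The vertex subgroups of the fundamental group. -/
def vertexSubgroup (T : WideSubquiver V) (a : V) : Subgroup (𝒢.FundamentalGroup T) :=
  (𝒢.vertexHom T a).range

/-- The edge subgroups of the fundamental group: the image of the edge group in the vertex subgroup
at the source of the edge (using the target instead gives a conjugate subgroup, and the same
subgroup if the edge is in `T`). -/
def edgeSubgroup (T : WideSubquiver V) {a b : V} (e : a ⟶ b) : Subgroup (𝒢.FundamentalGroup T) :=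
  ((𝒢.vertexHom T a).comp (𝒢.toSource e)).range

end GraphOfGroups

/-! Each edge of the tree splits `G` as an amalgam, over its edge subgroup `E`, of the subgroups
generated by the vertex groups on either side. If both factors are larger than `E`, then `E ⊔ H` has
finite index in `G` (`FirstLetter.finiteIndex_sup`). The reason is that starting with a letter of a
given factor is, up to finitely many cosets of `E`, unaffected by right multiplication by a fixed
element. If one factor equals `E`, that side of the tree is redundant; passing to a minimal
connected generating set of vertices removes all such edges (`exists_core`).

For every remaining edge, each `g` of length at most `n` is then `k * c * α` with `k ∈ H`, `c` in a
finite set, and `α` of length linear in `n` in both adjacent vertex groups. Follow the prefixes of a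
word of length `n` for an element of `H` and replace each by such a `k`. When the next letter lies
in a vertex group `A`, two successive approximations taken in `A` differ, up to finitely many
corrections, by a conjugate of an element of `A ∩ H` whose `A`-length is linear in `n`. Its cost is
the distortion in `A`. Changing from one vertex group to another is possible because adjacent ones
share approximations. Adding up the `n` steps gives the factor `n` (`exists_word_bound`). -/

/-! ### Amalgams via first letters -/

/-- First letters in an amalgam of the subgroups `Q i` over their common subgroup `E`: a function
`fst` such that multiplying from the left by a letter of `Q i` outside `E` gives an element that
starts with a letter of `Q i`, unless the factor already started with such a letter. -/
structure FirstLetter {G : Type*} [Group G] (E : Subgroup G) (Q : Bool → Subgroup G)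
    (fst : G → Option Bool) : Prop where
  le : ∀ i, E ≤ Q i
  gen : ⨆ i, Q i = ⊤
  one : fst 1 = none
  base_mul : ∀ x ∈ E, ∀ g, fst (x * g) = fst g
  letter_mul : ∀ i, ∀ y ∈ Q i, y ∉ E → ∀ g, fst g ≠ some i → fst (y * g) = some i

namespace FirstLetter

variable {G : Type*} [Group G] {E : Subgroup G} {Q : Bool → Subgroup G} {fst : G → Option Bool}

/-- Elements that are represented by a reduced word. -/
inductive HasReducedWord (E : Subgroup G) (Q : Bool → Subgroup G) (fst : G → Option Bool) : G → Prop
  | base {x : G} (hx : x ∈ E) : HasReducedWord E Q fst x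
  | cons {i : Bool} {y g : G} (hy : y ∈ Q i) (hyE : y ∉ E) (hg : fst g ≠ some i)
      (h : HasReducedWord E Q fst g) : HasReducedWord E Q fst (y * g)

theorem HasReducedWord.base_mul (hF : FirstLetter E Q fst) {x g : G} (hx : x ∈ E)
    (hg : HasReducedWord E Q fst g) : HasReducedWord E Q fst (x * g) := by
  cases hg with
  | base hg => exact .base (mul_mem hx hg)
  | cons hy hyE hg h =>
    rw [← mul_assoc]
    exact .cons (mul_mem (hF.le _ hx) hy) (fun h' => hyE ((mul_mem_cancel_left hx).1 h')) hg h

theorem HasReducedWord.letter_mul (hF : FirstLetter E Q fst) {i : Bool} {y g : G} (hy : y ∈ Q i)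
    (hg : HasReducedWord E Q fst g) : HasReducedWord E Q fst (y * g) := by
  by_cases hyE : y ∈ E
  · exact hg.base_mul hF hyE
  by_cases hi : fst g = some i
  · cases hg with
    | base hg => rw [← mul_one g, hF.base_mul _ hg, hF.one] at hi; cases hi
    | @cons j z g hz hzE hg h =>
      rw [hF.letter_mul j z hz hzE g hg] at hi
      cases hi
      rw [← mul_assoc]
      by_cases hyz : y * z ∈ E
      · exact h.base_mul hF hyz
      · exact .cons (mul_mem hy hz) hyz hg h
  · exact .cons hy hyE hi hg

theorem hasReducedWord (hF : FirstLetter E Q fst) (g : G) : HasReducedWord E Q fst g := by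
  have hg : g ∈ ⨆ i, Q i := hF.gen ▸ Subgroup.mem_top g
  rw [← mul_one g]
  have h1 : HasReducedWord E Q fst 1 := .base (one_mem E)
  revert h1
  generalize (1 : G) = k
  induction hg using Subgroup.iSup_induction' generalizing k with
  | hp i x hx => exact fun hk => hk.letter_mul hF hx
  | h1 => intro hk; rwa [one_mul]
  | hmul x y _ _ hx hy => intro hk; rw [mul_assoc]; exact hx _ (hy _ hk)

theorem eq_none_iff (hF : FirstLetter E Q fst) {g : G} : fst g = none ↔ g ∈ E := by
  refine ⟨fun h => ?_, fun h => by rw [← mul_one g, hF.base_mul _ h, hF.one]⟩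
  cases hF.hasReducedWord g with
  | base hg => exact hg
  | cons hy hyE hg _ => rw [hF.letter_mul _ _ hy hyE _ hg] at h; cases h

theorem eq_some (hF : FirstLetter E Q fst) {i : Bool} {y : G} (hy : y ∈ Q i) (hyE : y ∉ E) :
    fst y = some i := by
  rw [← mul_one y]
  exact hF.letter_mul i y hy hyE 1 (by rw [hF.one]; exact nofun)

theorem ne_some (hF : FirstLetter E Q fst) {i j : Bool} (hij : i ≠ j) {y : G} (hy : y ∈ Q i) :
    fst y ≠ some j := by
  by_cases hyE : y ∈ E
  · rw [hF.eq_none_iff.2 hyE]; exact nofun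
  · rw [hF.eq_some hy hyE]; simpa using hij

/-- A letter on the right only affects the end of a reduced word, so it can reach the first letter
only if the whole word is a single letter of the same factor or lies in `E`. -/
theorem mul_letter (hF : FirstLetter E Q fst) {i : Bool} {y : G} (hy : y ∈ Q i) {g : G}
    (hg : g ∉ Q i) : fst (g * y) = fst g := by
  induction hF.hasReducedWord g with
  | base hx => exact absurd (hF.le i hx) hg
  | @cons j z g hz hzE hgj h ih =>
    rw [hF.letter_mul j z hz hzE g hgj, mul_assoc]
    by_cases hgi : g ∈ Q i
    · have hij : i ≠ j := by
        rintro rfl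
        exact hg (mul_mem hz hgi)
      exact hF.letter_mul j z hz hzE _ (hF.ne_some hij (mul_mem hgi hy))
    · exact hF.letter_mul j z hz hzE _ (by rwa [ih hgi])

/-- There is no cancellation in `h * x` if `x` starts with a letter of another kind than `h⁻¹`. -/
theorem mul_of_ne (hF : FirstLetter E Q fst) {h x : G} (hh : h ∉ E) (hx : fst x ≠ fst h⁻¹) :
    fst (h * x) = fst h := by
  induction hF.hasReducedWord h with
  | base hE => exact absurd hE hh
  | @cons i y g hy hyE hg _ ih =>
    rw [hF.letter_mul i y hy hyE g hg]
    by_cases hgE : g ∈ E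
    · have hyg : y * g ∈ Q i := mul_mem hy (hF.le i hgE)
      rw [hF.eq_some (inv_mem hyg) (fun h' => hh (by simpa using inv_mem h'))] at hx
      exact hF.letter_mul i _ hyg hh x hx
    · have hgi : g⁻¹ ∉ Q i := fun h' =>
        hg (hF.eq_some (by simpa using inv_mem h') hgE)
      rw [mul_inv_rev, hF.mul_letter (inv_mem hy) hgi] at hx
      rw [mul_assoc]
      exact hF.letter_mul i y hy hyE _ (by rwa [ih hgE hx])

/-- Almost invariance of first letters: the exceptional `g` lie in finitely many cosets `E * d⁻¹`.
For a letter `y` of `Q i` they have `g ∈ E` or `g * y ∈ E`, and products of letters follow by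
composing. -/
theorem exists_finset_of_ne (hF : FirstLetter E Q fst) (k : G) :
    ∃ D : Set G, D.Finite ∧ ∀ g, fst g ≠ fst (g * k) → ∃ d ∈ D, g * d ∈ E := by
  have hk : k ∈ ⨆ i, Q i := hF.gen ▸ Subgroup.mem_top k
  induction hk using Subgroup.iSup_induction' with
  | hp i y hy =>
    refine ⟨{1, y}, Set.toFinite _, fun g hg => ?_⟩
    by_cases hgi : g ∈ Q i
    · by_contra! hcon
      have h1 := hcon 1 (by simp)
      have h2 := hcon y (by simp)
      rw [mul_one] at h1
      exact hg ((hF.eq_some hgi h1).trans (hF.eq_some (mul_mem hgi hy) h2).symm)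
    · exact absurd (hF.mul_letter hy hgi).symm hg
  | h1 => exact ⟨∅, Set.finite_empty, fun g hg => absurd (by rw [mul_one]) hg⟩
  | hmul x y _ _ hx hy =>
    obtain ⟨D, hD, hx⟩ := hx
    obtain ⟨D', hD', hy⟩ := hy
    refine ⟨D ∪ (fun d => x * d) '' D', hD.union (hD'.image _), fun g hg => ?_⟩
    by_cases h : fst g = fst (g * x)
    · rw [h, ← mul_assoc] at hg
      obtain ⟨d, hd, hdE⟩ := hy _ hg
      exact ⟨x * d, Or.inr ⟨d, hd, rfl⟩, by rwa [← mul_assoc]⟩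
    · obtain ⟨d, hd, hdE⟩ := hx _ h
      exact ⟨d, Or.inl hd, hdE⟩

/-- Only finitely many cosets of `E ⊔ H` meet the exceptional sets of the generators of `H`, so
infinite index leaves a `g` for which `g * H` avoids them all. The first letter is constant on `g *
H`, which is `H * g` by normality. -/
theorem exists_mem_forall_mul (hF : FirstLetter E Q fst) {H : Subgroup G} [H.Normal] (hH : H.FG)
    (hfin : ¬ (E ⊔ H).FiniteIndex) : ∃ g i, ∀ h ∈ H, fst (h * g) = some i := by
  obtain ⟨T, rfl⟩ := hH
  set H := Subgroup.closure (T : Set G)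
  choose D hD hDE using hF.exists_finset_of_ne
  -- The element `1` is included to force `g ∉ E`, so that `g` has a first letter.
  set D₀ : Set G := {1} ∪ ⋃ t ∈ T, D t
  have hD₀ : D₀.Finite := (Set.finite_singleton 1).union (T.finite_toSet.biUnion fun t _ => hD t)
  obtain ⟨g, hg⟩ : ∃ g, ∀ h ∈ H, ∀ d ∈ D₀, g * h * d ∉ E := by
    by_contra! hcon
    refine hfin ?_
    have : Finite D₀ := hD₀
    have hsurj : Function.Surjective (fun d : D₀ => (d.1 : G ⧸ (E ⊔ H))) := by
      intro q
      obtain ⟨g, rfl⟩ := QuotientGroup.mk_surjective q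
      obtain ⟨h, hh, d, hd, hE⟩ := hcon g⁻¹
      refine ⟨⟨d, hd⟩, QuotientGroup.eq.2 ?_⟩
      have h1 : d⁻¹ * g = (g⁻¹ * h * d)⁻¹ * (g⁻¹ * h * g) := by group
      rw [h1]
      refine mul_mem (inv_mem (Subgroup.mem_sup_left hE)) (Subgroup.mem_sup_right ?_)
      simpa using ‹H.Normal›.conj_mem h hh g⁻¹
    have : Finite (G ⧸ (E ⊔ H)) := Finite.of_surjective _ hsurj
    exact Subgroup.finiteIndex_of_finite_quotient
  have key : ∀ h ∈ H, ∀ g, (∀ h ∈ H, ∀ d ∈ D₀, g * h * d ∉ E) → fst (g * h) = fst g := by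
    intro h hh
    induction hh using Subgroup.closure_induction with
    | mem t ht =>
      intro g hg
      by_contra hne
      obtain ⟨d, hd, hE⟩ := hDE t g (Ne.symm hne)
      exact hg 1 (one_mem H) d (Or.inr (Set.mem_biUnion ht hd)) (by rwa [mul_one])
    | one => intro g _; rw [mul_one]
    | mul x y hx _ ihx ihy =>
      intro g hg
      rw [← mul_assoc, ihy, ihx g hg]
      intro h hh d hd
      rw [mul_assoc g]
      exact hg _ (mul_mem hx hh) d hd
    | inv x hx ihx =>
      intro g hg
      rw [← ihx (g * x⁻¹), inv_mul_cancel_right]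
      intro h hh d hd
      rw [mul_assoc g]
      exact hg _ (mul_mem (inv_mem hx) hh) d hd
  have hgE : g ∉ E := by simpa using hg 1 (one_mem H) 1 (Or.inl rfl)
  obtain ⟨i, hi⟩ := Option.ne_none_iff_exists'.1 (mt hF.eq_none_iff.1 hgE)
  refine ⟨g, i, fun h hh => ?_⟩
  have h1 : h * g = g * (g⁻¹ * h * g) := by group
  rw [h1, key _ (by simpa using ‹H.Normal›.conj_mem h hh g⁻¹) g hg, hi]

/-- All `h ^ n * g` lie in finitely many cosets `E * d⁻¹`, so two of them share a coset; their
quotient is a power of `h` in `E`. -/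
theorem exists_pow_mem (hF : FirstLetter E Q fst) {H : Subgroup G} {g g' : G}
    (hne : ∀ h ∈ H, fst (h * g) ≠ fst (h * g')) {h : G} (hh : h ∈ H) :
    ∃ n : ℕ, h ^ (n + 1) ∈ E := by
  obtain ⟨D, hD, hDE⟩ := hF.exists_finset_of_ne (g⁻¹ * g')
  have hex : ∀ n : ℕ, ∃ d ∈ D, h ^ n * g * d ∈ E := fun n =>
    hDE _ (by simpa [mul_assoc] using hne _ (pow_mem hh n))
  choose d hd hdE using hex
  have : Finite D := hD
  obtain ⟨n, m, hnm, heq⟩ := Finite.exists_ne_map_eq_of_infinite (fun n : ℕ => (⟨d n, hd n⟩ : D))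
  wlog hlt : n < m generalizing n m
  · exact this m n hnm.symm heq.symm (lt_of_le_of_ne (not_lt.1 hlt) hnm.symm)
  have heq' : d n = d m := congrArg Subtype.val heq
  obtain ⟨k, rfl⟩ := Nat.exists_eq_add_of_lt hlt
  refine ⟨k, ?_⟩
  have h1 : h ^ (k + 1) = (h ^ (n + k + 1) * g * d (n + k + 1)) * (h ^ n * g * d n)⁻¹ := by
    rw [heq', add_assoc, add_comm n, pow_add]; group
  rw [h1]
  exact mul_mem (hdE _) (inv_mem (hdE _))

/-- A finitely generated normal subgroup of a nondegenerate amalgam that is not contained in the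
amalgamated subgroup `E` has finite index modulo `E`. -/
theorem finiteIndex_sup (hF : FirstLetter E Q fst) (hQ : ∀ i, ¬ Q i ≤ E) {H : Subgroup G}
    [H.Normal] (hH : H.FG) (hHE : ¬ H ≤ E) : (E ⊔ H).FiniteIndex := by
  by_contra hfin
  obtain ⟨g, i, hg⟩ := hF.exists_mem_forall_mul hH hfin
  -- Prefixing a letter of the other factor gives a second coset, `H * (y * g)`, on which the first
  -- letter is constantly `!i`.
  obtain ⟨y, hy, hyE⟩ := Set.not_subset.1 (hQ (!i))
  have hg' : ∀ h ∈ H, fst (h * (y * g)) = some (!i) := by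
    intro h hh
    have h1 : h * (y * g) = y * ((y⁻¹ * h * y) * g) := by group
    rw [h1]
    refine hF.letter_mul _ y hy hyE _ ?_
    rw [hg _ (by simpa using ‹H.Normal›.conj_mem h hh y⁻¹)]
    simp
  refine hHE fun h hh => ?_
  by_contra hE
  have hE' : h⁻¹ ∉ E := fun h' => hE (by simpa using inv_mem h')
  obtain ⟨k, hk⟩ := Option.ne_none_iff_exists'.1 (mt hF.eq_none_iff.1 hE)
  obtain ⟨l, hl⟩ := Option.ne_none_iff_exists'.1 (mt hF.eq_none_iff.1 hE')
  -- If `h` and `h⁻¹` start in the same factor, some `x` among `g` and `y * g` starts in the other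
  -- one; then `h * x` starts like `h`, against constancy on `H * x`. Otherwise `h` is cyclically
  -- reduced, and none of its positive powers lies in `E`.
  by_cases hkl : k = l
  · obtain ⟨x, hx, hxl⟩ : ∃ x, (∀ h ∈ H, fst (h * x) = fst x) ∧ fst x ≠ some l := by
      have h1 := hg 1 (one_mem H)
      have h2 := hg' 1 (one_mem H)
      rw [one_mul] at h1 h2
      by_cases hil : i = l
      · exact ⟨y * g, fun h hh => by rw [hg' h hh, h2], by rw [h2, hil]; simp⟩
      · exact ⟨g, fun h hh => by rw [hg h hh, h1], by rw [h1]; simpa using hil⟩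
    have := hF.mul_of_ne hE (x := x) (by rwa [hl])
    rw [hx h hh, hk, hkl] at this
    exact hxl this
  · obtain ⟨n, hn⟩ := hF.exists_pow_mem (g := g) (g' := y * g)
      (fun h hh => by rw [hg h hh, hg' h hh]; simp) hh
    have hpow : ∀ n : ℕ, fst (h ^ (n + 1)) = some k := by
      intro n
      induction n with
      | zero => simpa using hk
      | succ n ih => rw [pow_succ', hF.mul_of_ne hE (by rw [ih, hl]; simpa using hkl), hk]
    have := hpow n
    rw [hF.eq_none_iff.2 hn] at this
    cases this

end FirstLetter

/-! ### First letters from normal forms in pushouts. -/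

section PushoutFirstLetter

variable {G : Type*} [Group G] {E : Subgroup G} {Q : Bool → Subgroup G}

open Monoid in
/-- The normal form theorem gives first letters in an amalgam. -/
theorem FirstLetter.exists_of_hom (hE : ∀ i, E ≤ Q i) (hgen : ⨆ i, Q i = ⊤)
    (φ : G →* PushoutI (fun i => Subgroup.inclusion (hE i)))
    (hφ : ∀ i x (hx : x ∈ Q i), φ x = PushoutI.of i ⟨x, hx⟩) :
    ∃ fst, FirstLetter E Q fst := by
  classical
  obtain ⟨d⟩ := PushoutI.NormalWord.transversal_nonempty (fun i => Subgroup.inclusion (hE i))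
    (fun i => Subgroup.inclusion_injective (hE i))
  refine ⟨fun g => (φ g • (PushoutI.NormalWord.empty : PushoutI.NormalWord d)).fstIdx,
    hE, hgen, ?_, ?_, ?_⟩
  · rw [map_one, one_smul]; rfl
  · intro x hx g
    have h1 : φ x = PushoutI.base _ ⟨x, hx⟩ := by
      rw [hφ true x (hE _ hx), ← PushoutI.of_apply_eq_base _ true]
      rfl
    rw [map_mul, mul_smul, h1, PushoutI.NormalWord.base_smul_def]
  · intro i y hy hyE g hg
    have hy' : (⟨y, hy⟩ : Q i) ∉ (Subgroup.inclusion (hE i)).range := by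
      rintro ⟨x, hx⟩
      have hxy : (x : G) = y := congrArg Subtype.val hx
      exact hyE (hxy ▸ x.2)
    rw [map_mul, mul_smul, hφ i y hy, ← PushoutI.NormalWord.cons_eq_smul _ _ hg hy']
    simp [PushoutI.NormalWord.cons]

end PushoutFirstLetter

/-! ### Cuts and connectivity in simply connected graphs. -/

section Cut

variable {V : Type u} [Quiver.{v} V]

open CategoryTheory in
/-- Removing an edge disconnects a simply connected graph. -/
theorem IsSimplyConnectedGraph.exists_cut (hV : IsSimplyConnectedGraph V) {a b : V} (e : a ⟶ b) :
    ∃ σ : V → Bool, σ a = false ∧ σ b = true ∧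
      ∀ {c d : V} (f : c ⟶ d), Quiver.Total.mk c d f ≠ Quiver.Total.mk a b e → σ c = σ d := by
  classical
  -- The signed number of passages through `e` extends to homotopy classes of paths. Counted on the
  -- unique class from `a`, it is `0` at `a`, `1` at `b`, and changes only across `e`.
  let φ : V ⥤q SingleObj (Multiplicative ℤ) :=
    { obj := fun _ => SingleObj.star _
      map := fun {c d} f => (if Quiver.Total.mk c d f = Quiver.Total.mk a b e
        then Multiplicative.ofAdd 1 else 1 : Multiplicative ℤ) }
  let Φ := Quiver.FreeGroupoid.lift φ
  let ob := (Quiver.FreeGroupoid.of V).obj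
  have huniq : ∀ {c d : V} (p q : ob c ⟶ ob d), p = q := fun {c d} p q =>
    (hV.2 c d).elim fun h => (h.eq_default p).trans (h.eq_default q).symm
  let p : ∀ c : V, ob a ⟶ ob c := fun c => (hV.2 a c).some.default
  let s : V → ℤ := fun c => Multiplicative.toAdd (show Multiplicative ℤ from Φ.map (p c))
  have hmap : ∀ {c d : V} (f : c ⟶ d), Φ.map ((Quiver.FreeGroupoid.of V).map f) = φ.map f := by
    intro c d f
    have := Quiver.FreeGroupoid.lift_spec φ
    exact eq_of_heq (by
      have h2 := congr_arg_heq (fun F : V ⥤q SingleObj (Multiplicative ℤ) => F.map f) this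
      exact h2)
  have hstep : ∀ {c d : V} (f : c ⟶ d), s d = s c +
      Multiplicative.toAdd (show Multiplicative ℤ from φ.map f) := by
    intro c d f
    have h1 : p d = p c ≫ (Quiver.FreeGroupoid.of V).map f := huniq _ _
    simp only [s]
    rw [h1, Φ.map_comp, hmap f]
    exact add_comm _ _
  have ha : s a = 0 := by
    have h1 : p a = 𝟙 _ := huniq _ _
    simp only [s]
    rw [h1, Φ.map_id]
    rfl
  have hb : s b = 1 := by
    rw [hstep e, ha]
    simp [φ]
  refine ⟨fun c => decide (1 ≤ s c), by simp [ha], by simp [hb], fun {c d} f hf => ?_⟩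
  simp [hstep f, φ, hf]

/-- Two vertices are adjacent if they are joined by an edge in one of the directions. -/
def QuiverAdj (a b : V) : Prop := Nonempty (a ⟶ b) ∨ Nonempty (b ⟶ a)

open CategoryTheory in
theorem IsSimplyConnectedGraph.reflTransGen (hV : IsSimplyConnectedGraph V) (a b : V) :
    Relation.ReflTransGen QuiverAdj a b := by
  obtain ⟨f⟩ := (hV.2 a b)
  obtain ⟨p, -⟩ := Quot.exists_rep (f.default)
  have key : ∀ {x y : V} (p : @Quiver.Path (Quiver.Symmetrify V) _ x y),
      Relation.ReflTransGen (QuiverAdj (V := V)) x y := by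
    intro x y p
    induction p with
    | nil => exact .refl
    | cons _ f ih =>
      refine ih.tail ?_
      rcases f with f | f
      · exact Or.inl ⟨f⟩
      · exact Or.inr ⟨f⟩
  exact key p

end Cut

/-! ### Splitting the fundamental group along an edge. -/

namespace GraphOfGroups

variable {V : Type u} [Quiver.{v} V] (𝒢 : GraphOfGroups.{u, v, w} V)

theorem mk_stableLetter {a b : V} (e : a ⟶ b) :
    (QuotientGroup.mk (𝒢.stableLetter e) : 𝒢.FundamentalGroup ⊤) = 1 :=
  (QuotientGroup.eq_one_iff _).2
    (Subgroup.subset_normalClosure (Or.inr ⟨a, b, e, Set.mem_univ _, rfl⟩))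

theorem vertexHom_toTarget {a b : V} (e : a ⟶ b) (c : 𝒢.edgeGroup e) :
    𝒢.vertexHom ⊤ b (𝒢.toTarget e c) = 𝒢.vertexHom ⊤ a (𝒢.toSource e c) := by
  have h := (QuotientGroup.eq_one_iff (N := Subgroup.normalClosure (𝒢.relators ⊤)) _).2
    (Subgroup.subset_normalClosure (Or.inl ⟨a, b, e, c, rfl⟩))
  simp only [QuotientGroup.mk_mul, QuotientGroup.mk_inv, 𝒢.mk_stableLetter e, one_mul, inv_one,
    mul_one] at h
  exact mul_inv_eq_one.1 h

theorem edgeSubgroup_le_source {a b : V} (e : a ⟶ b) :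
    𝒢.edgeSubgroup ⊤ e ≤ 𝒢.vertexSubgroup ⊤ a := by
  rintro _ ⟨c, rfl⟩
  exact ⟨_, rfl⟩

theorem edgeSubgroup_le_target {a b : V} (e : a ⟶ b) :
    𝒢.edgeSubgroup ⊤ e ≤ 𝒢.vertexSubgroup ⊤ b := by
  rintro _ ⟨c, rfl⟩
  exact ⟨_, 𝒢.vertexHom_toTarget e c⟩

/-- The universal property of the fundamental group of a tree of groups. -/
theorem exists_hom {K : Type*} [Group K] (f : ∀ a, 𝒢.vertexGroup a →* K)
    (hf : ∀ {a b : V} (e : a ⟶ b) (c : 𝒢.edgeGroup e),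
      f b (𝒢.toTarget e c) = f a (𝒢.toSource e c)) :
    ∃ φ : 𝒢.FundamentalGroup ⊤ →* K, ∀ a x, φ (𝒢.vertexHom ⊤ a x) = f a x := by
  let ψ : 𝒢.PathGroup →* K := Monoid.Coprod.lift (Monoid.CoprodI.lift f) (FreeGroup.lift fun _ => 1)
  have hψv : ∀ a x, ψ (𝒢.vertexIncl a x) = f a x := by
    intro a x
    simp [ψ, vertexIncl]
  have hψs : ∀ {a b : V} (e : a ⟶ b), ψ (𝒢.stableLetter e) = 1 := by
    intro a b e
    simp [ψ, stableLetter]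
  refine ⟨QuotientGroup.lift _ ψ ?_, fun a x => hψv a x⟩
  refine Subgroup.normalClosure_le_normal ?_
  rintro _ (⟨a, b, e, c, rfl⟩ | ⟨a, b, e, -, rfl⟩)
  · simp [MonoidHom.mem_ker, hψv, hψs, hf]
  · exact hψs e

theorem iSup_vertexSubgroup : ⨆ a, 𝒢.vertexSubgroup ⊤ a = ⊤ := by
  rw [eq_top_iff]
  rintro g -
  obtain ⟨x, rfl⟩ := QuotientGroup.mk_surjective g
  let q := QuotientGroup.mk' (Subgroup.normalClosure (𝒢.relators ⊤))
  change q x ∈ _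
  induction x using Monoid.Coprod.induction_on with
  | inl x =>
    induction x using Monoid.CoprodI.induction_on with
    | one => rw [map_one, map_one]; exact one_mem _
    | of a x => exact Subgroup.mem_iSup_of_mem a ⟨x, rfl⟩
    | mul x y hx hy => rw [map_mul, map_mul]; exact mul_mem hx hy
  | inr x =>
    have h1 : (q.comp Monoid.Coprod.inr : FreeGroup (Quiver.Total V) →* _) = 1 := by
      ext e
      exact 𝒢.mk_stableLetter e.hom
    have h2 := DFunLike.congr_fun h1 x
    rw [show q (Monoid.Coprod.inr x) = 1 from h2]
    exact one_mem _
  | mul x y hx hy => rw [map_mul]; exact mul_mem hx hy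

/-- The subgroup generated by the vertex subgroups on one side of a cut. -/
def sideSubgroup (σ : V → Bool) (i : Bool) : Subgroup (𝒢.FundamentalGroup ⊤) :=
  ⨆ (a) (_ : σ a = i), 𝒢.vertexSubgroup ⊤ a

theorem vertexSubgroup_le_sideSubgroup (σ : V → Bool) (a : V) :
    𝒢.vertexSubgroup ⊤ a ≤ 𝒢.sideSubgroup σ (σ a) :=
  le_iSup₂_of_le a rfl le_rfl

/-- An edge splits the fundamental group of a tree of groups as an amalgam. -/
theorem exists_firstLetter {σ : V → Bool} {a b : V} (e : a ⟶ b) (ha : σ a = false)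
    (hb : σ b = true)
    (hσ : ∀ {c d : V} (f : c ⟶ d), Quiver.Total.mk c d f ≠ Quiver.Total.mk a b e → σ c = σ d) :
    ∃ fst, FirstLetter (𝒢.edgeSubgroup ⊤ e) (𝒢.sideSubgroup σ) fst := by
  have hE : ∀ i, 𝒢.edgeSubgroup ⊤ e ≤ 𝒢.sideSubgroup σ i := by
    rintro (_ | _)
    · exact ha ▸ (𝒢.edgeSubgroup_le_source e).trans (𝒢.vertexSubgroup_le_sideSubgroup σ a)
    · exact hb ▸ (𝒢.edgeSubgroup_le_target e).trans (𝒢.vertexSubgroup_le_sideSubgroup σ b)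
  have hgen : ⨆ i, 𝒢.sideSubgroup σ i = ⊤ := by
    rw [eq_top_iff, ← 𝒢.iSup_vertexSubgroup]
    exact iSup_le fun c => le_iSup_of_le (σ c) (𝒢.vertexSubgroup_le_sideSubgroup σ c)
  have hmem : ∀ c x, 𝒢.vertexHom ⊤ c x ∈ 𝒢.sideSubgroup σ (σ c) := fun c x =>
    𝒢.vertexSubgroup_le_sideSubgroup σ c ⟨x, rfl⟩
  have hof : ∀ {i j : Bool} (x : 𝒢.FundamentalGroup ⊤) (hi : x ∈ 𝒢.sideSubgroup σ i)
      (hj : x ∈ 𝒢.sideSubgroup σ j), (i = j ∨ x ∈ 𝒢.edgeSubgroup ⊤ e) →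
      (Monoid.PushoutI.of i ⟨x, hi⟩ : Monoid.PushoutI fun i => Subgroup.inclusion (hE i)) =
        Monoid.PushoutI.of j ⟨x, hj⟩ := by
    rintro i j x hi hj (rfl | hx)
    · rfl
    · exact (Monoid.PushoutI.of_apply_eq_base (fun i => Subgroup.inclusion (hE i)) i ⟨x, hx⟩).trans
        (Monoid.PushoutI.of_apply_eq_base (fun i => Subgroup.inclusion (hE i)) j ⟨x, hx⟩).symm
  -- Each vertex group maps to the factor on its side. Edges other than `e` stay on one side, and
  -- the edge group of `e` is amalgamated, so the maps are compatible.
  obtain ⟨φ, hφ⟩ := 𝒢.exists_hom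
    (K := Monoid.PushoutI fun i => Subgroup.inclusion (hE i))
    (fun c => (Monoid.PushoutI.of (σ c)).comp ((𝒢.vertexHom ⊤ c).codRestrict _ (hmem c)))
    (by
      intro c d f x
      have h1 := 𝒢.vertexHom_toTarget f x
      have h2 := hmem d (𝒢.toTarget f x)
      rw [h1] at h2
      have h3 : (𝒢.vertexHom ⊤ d).codRestrict _ (hmem d) (𝒢.toTarget f x) =
        ⟨𝒢.vertexHom ⊤ c (𝒢.toSource f x), h2⟩ := Subtype.ext h1
      simp only [MonoidHom.comp_apply, h3]
      refine hof _ _ _ ?_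
      by_cases hf : Quiver.Total.mk c d f = Quiver.Total.mk a b e
      · cases hf
        exact Or.inr ⟨x, rfl⟩
      · exact Or.inl (hσ f hf).symm)
  refine FirstLetter.exists_of_hom hE hgen φ fun i x hx => ?_
  let ofi : 𝒢.sideSubgroup σ i →* Monoid.PushoutI fun i => Subgroup.inclusion (hE i) :=
    Monoid.PushoutI.of (G := fun i => 𝒢.sideSubgroup σ i) i
  have key : (φ.comp (𝒢.sideSubgroup σ i).subtype).eqLocus ofi = ⊤ := by
    have hle : 𝒢.sideSubgroup σ i ≤ ((φ.comp (𝒢.sideSubgroup σ i).subtype).eqLocus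
        ofi).map (𝒢.sideSubgroup σ i).subtype := by
      refine iSup₂_le fun c hc => ?_
      subst hc
      rintro _ ⟨y, rfl⟩
      exact ⟨⟨_, hmem c y⟩, hφ c y, rfl⟩
    rw [eq_top_iff]
    rintro ⟨y, hy⟩ -
    obtain ⟨z, hz, rfl⟩ := hle hy
    exact hz
  have := key.ge (Subgroup.mem_top ⟨x, hx⟩)
  exact this

/-- The second alternative is the degenerate amalgam, where one side contributes nothing beyond the
edge subgroup. -/
theorem finiteIndex_or_sideSubgroup_le {σ : V → Bool} {a b : V} (e : a ⟶ b) (ha : σ a = false)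
    (hb : σ b = true)
    (hσ : ∀ {c d : V} (f : c ⟶ d), Quiver.Total.mk c d f ≠ Quiver.Total.mk a b e → σ c = σ d)
    {H : Subgroup (𝒢.FundamentalGroup ⊤)} (hnormal : H.Normal) (hH : H.FG)
    (hHe : ¬ H ≤ 𝒢.edgeSubgroup ⊤ e) :
    (𝒢.edgeSubgroup ⊤ e ⊔ H).FiniteIndex ∨ ∃ i, 𝒢.sideSubgroup σ i ≤ 𝒢.edgeSubgroup ⊤ e := by
  obtain ⟨fst, hF⟩ := 𝒢.exists_firstLetter e ha hb hσ
  by_cases hQ : ∃ i, 𝒢.sideSubgroup σ i ≤ 𝒢.edgeSubgroup ⊤ e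
  · exact Or.inr hQ
  · exact Or.inl (hF.finiteIndex_sup (not_exists.1 hQ) hH hHe)

end GraphOfGroups

/-! ### Discarding redundant sides of the tree. -/

namespace GraphOfGroups

variable {V : Type u} [Quiver.{v} V] (𝒢 : GraphOfGroups.{u, v, w} V)

/-- A nonempty set `W` of vertices that is connected in the graph and whose vertex subgroups
generate the fundamental group. -/
structure IsConnectedGenerating (W : Set V) : Prop where
  nonempty : W.Nonempty
  iSup_eq : ⨆ a ∈ W, 𝒢.vertexSubgroup ⊤ a = ⊤
  reflTransGen : ∀ x ∈ W, ∀ y ∈ W,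
    Relation.ReflTransGen (fun u u' => u ∈ W ∧ u' ∈ W ∧ QuiverAdj u u') x y

/-- If all vertex groups on the side `i` of an edge are contained in the edge group, then the
vertices on that side can be dropped. -/
theorem IsConnectedGenerating.inter_side {W : Set V} (hW : 𝒢.IsConnectedGenerating W)
    {σ : V → Bool} {a b : V} (e : a ⟶ b) (ha : σ a = false) (hb : σ b = true)
    (hσ : ∀ {c d : V} (f : c ⟶ d), Quiver.Total.mk c d f ≠ Quiver.Total.mk a b e → σ c = σ d)
    (haW : a ∈ W) (hbW : b ∈ W) {i : Bool} (hi : 𝒢.sideSubgroup σ i ≤ 𝒢.edgeSubgroup ⊤ e) :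
    𝒢.IsConnectedGenerating {u ∈ W | σ u ≠ i} := by
  -- The vertex `p` is the endpoint of `e` on the surviving side; its vertex subgroup absorbs
  -- everything dropped.
  obtain ⟨p, hp, hpW, hpE, hpab⟩ : ∃ p, σ p ≠ i ∧ p ∈ W ∧
      𝒢.edgeSubgroup ⊤ e ≤ 𝒢.vertexSubgroup ⊤ p ∧
      ((σ a ≠ i → a = p) ∧ (σ b ≠ i → b = p)) := by
    cases i
    · exact ⟨b, by simp [hb], hbW, 𝒢.edgeSubgroup_le_target e, by simp [ha, hb]⟩
    · exact ⟨a, by simp [ha], haW, 𝒢.edgeSubgroup_le_source e, by simp [ha, hb]⟩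
  refine ⟨⟨p, hpW, hp⟩, ?_, ?_⟩
  · rw [eq_top_iff, ← hW.iSup_eq]
    refine iSup₂_le fun u hu => ?_
    by_cases hui : σ u = i
    · exact ((hui ▸ 𝒢.vertexSubgroup_le_sideSubgroup σ u).trans hi).trans
        (hpE.trans (le_iSup₂_of_le p ⟨hpW, hp⟩ le_rfl))
    · exact le_iSup₂_of_le u ⟨hu, hui⟩ le_rfl
  -- Collapsing the dropped side to `p` turns walks in `W` into walks on the surviving side, since
  -- only `e` crosses the cut and both its ends go to `p`.
  · let ρ : V → V := fun u => if σ u = i then p else u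
    have hρ : ∀ {u}, σ u ≠ i → ρ u = u := fun h => if_neg h
    have hρe : ∀ {c d : V} (f : c ⟶ d), σ c = σ d ∨ ρ c = ρ d := by
      intro c d f
      by_cases hf : Quiver.Total.mk c d f = Quiver.Total.mk a b e
      · cases hf
        have h1 : ∀ u, (σ u ≠ i → u = p) → ρ u = p := by
          intro u hu
          by_cases hui : σ u = i
          · exact if_pos hui
          · rw [hρ hui, hu hui]
        exact Or.inr ((h1 a hpab.1).trans (h1 b hpab.2).symm)
      · exact Or.inl (hσ f hf)
    have key : ∀ x y, Relation.ReflTransGen (fun u u' => u ∈ W ∧ u' ∈ W ∧ QuiverAdj u u') x y →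
        Relation.ReflTransGen (fun u u' => u ∈ {u ∈ W | σ u ≠ i} ∧ u' ∈ {u ∈ W | σ u ≠ i} ∧
          QuiverAdj u u') (ρ x) (ρ y) := by
      intro x y hxy
      induction hxy with
      | refl => exact .refl
      | @tail y z _ hyz ih =>
        obtain ⟨hy, hz, hadj⟩ := hyz
        have h1 : σ y = σ z ∨ ρ y = ρ z := by
          rcases hadj with ⟨⟨f⟩⟩ | ⟨⟨f⟩⟩
          · exact hρe f
          · exact (hρe f).imp Eq.symm Eq.symm
        rcases h1 with h1 | h1
        · by_cases hyi : σ y = i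
          · have h2 : ρ y = ρ z := (if_pos hyi).trans (if_pos (h1.symm.trans hyi)).symm
            rwa [← h2]
          · have hzi : σ z ≠ i := fun h => hyi (h1.trans h)
            refine ih.tail ?_
            rw [hρ hyi, hρ hzi]
            exact ⟨⟨hy, hyi⟩, ⟨hz, hzi⟩, hadj⟩
        · rwa [← h1]
    rintro x ⟨hx, hxi⟩ y ⟨hy, hyi⟩
    have := key x y (hW.reflTransGen x hx y hy)
    rwa [hρ hxi, hρ hyi] at this

/-- Take `W` minimal. A degenerate edge inside `W` would allow a whole side to be dropped, including
one endpoint of that edge, against minimality. -/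
theorem exists_core [Finite V] (hV : IsSimplyConnectedGraph V)
    {H : Subgroup (𝒢.FundamentalGroup ⊤)} (hnormal : H.Normal) (hH : H.FG)
    (hedge : ∀ (a b : V) (e : a ⟶ b), ¬ H ≤ 𝒢.edgeSubgroup ⊤ e) :
    ∃ W, 𝒢.IsConnectedGenerating W ∧
      ∀ a ∈ W, ∀ b ∈ W, ∀ e : a ⟶ b, (𝒢.edgeSubgroup ⊤ e ⊔ H).FiniteIndex := by
  have huniv : 𝒢.IsConnectedGenerating Set.univ := by
    refine ⟨?_, by simpa using 𝒢.iSup_vertexSubgroup, fun x _ y _ => ?_⟩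
    · obtain ⟨a⟩ := hV.1
      exact ⟨a, trivial⟩
    · simpa using hV.reflTransGen x y
  obtain ⟨W, hW⟩ := exists_minimal_of_wellFoundedLT 𝒢.IsConnectedGenerating ⟨_, huniv⟩
  refine ⟨W, hW.prop, fun a ha b hb e => ?_⟩
  obtain ⟨σ, hσa, hσb, hσ⟩ := hV.exists_cut e
  refine (𝒢.finiteIndex_or_sideSubgroup_le e hσa hσb hσ hnormal hH (hedge a b e)).resolve_right ?_
  rintro ⟨i, hi⟩
  have hle := hW.le_of_le (hW.prop.inter_side 𝒢 e hσa hσb hσ ha hb hi) (fun u hu => hu.1)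
  have h1 := (hle ha).2
  have h2 := (hle hb).2
  rw [hσa] at h1
  rw [hσb] at h2
  cases i <;> simp at h1 h2

end GraphOfGroups

/-! ### Balls for the word length -/

section WordBall

variable {G : Type*} [Group G]

/-- The ball of radius `n` for the word length. -/
def wordBall (S : Set G) (n : ℕ) : Set G :=
  {g | ∃ l : List G, l.length ≤ n ∧ (∀ x ∈ l, x ∈ S ∨ x⁻¹ ∈ S) ∧ l.prod = g}

variable {S : Set G}

theorem wordLength_le_iff {g : G} {n : ℕ} : wordLength S g ≤ n ↔ g ∈ wordBall S n := by
  constructor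
  · intro h
    by_contra hg
    have h1 : ((n + 1 : ℕ) : ℕ∞) ≤ wordLength S g := by
      refine le_iInf₂ fun l hl => ?_
      by_contra hlt
      refine hg ⟨l, ?_, hl⟩
      have := Nat.cast_lt.1 (not_le.1 hlt)
      omega
    have := Nat.cast_le.1 (h1.trans h)
    omega
  · rintro ⟨l, hln, hl⟩
    exact (iInf₂_le l hl).trans (Nat.cast_le.2 hln)

theorem one_mem_wordBall (n : ℕ) : (1 : G) ∈ wordBall S n := ⟨[], by simp, by simp, rfl⟩

theorem wordBall_mono {m n : ℕ} (h : m ≤ n) : wordBall S m ⊆ wordBall S n := by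
  rintro _ ⟨l, hl, hS, rfl⟩
  exact ⟨l, hl.trans h, hS, rfl⟩

theorem mem_wordBall_one {g : G} (hg : g ∈ S ∨ g⁻¹ ∈ S) : g ∈ wordBall S 1 :=
  ⟨[g], by simp, by simpa using hg, by simp⟩

theorem mul_mem_wordBall {m n : ℕ} {g h : G} (hg : g ∈ wordBall S m) (hh : h ∈ wordBall S n) :
    g * h ∈ wordBall S (m + n) := by
  obtain ⟨l, hl, hS, rfl⟩ := hg
  obtain ⟨l', hl', hS', rfl⟩ := hh
  refine ⟨l ++ l', by simp; omega, fun x hx => ?_, by simp⟩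
  rcases List.mem_append.1 hx with hx | hx
  · exact hS x hx
  · exact hS' x hx

theorem inv_mem_wordBall {n : ℕ} {g : G} (hg : g ∈ wordBall S n) : g⁻¹ ∈ wordBall S n := by
  obtain ⟨l, hl, hS, rfl⟩ := hg
  refine ⟨(l.map fun x => x⁻¹).reverse, by simpa using hl, fun x hx => ?_,
    (List.prod_inv_reverse l).symm⟩
  obtain ⟨y, hy, rfl⟩ := List.mem_map.1 (List.mem_reverse.1 hx)
  rw [inv_inv]
  exact (hS y hy).symm

theorem exists_mem_wordBall (hS : Subgroup.closure S = ⊤) (g : G) : ∃ n, g ∈ wordBall S n := by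
  have hg : g ∈ Subgroup.closure S := hS ▸ Subgroup.mem_top g
  induction hg using Subgroup.closure_induction with
  | mem x hx => exact ⟨1, mem_wordBall_one (Or.inl hx)⟩
  | one => exact ⟨0, one_mem_wordBall 0⟩
  | mul x y _ _ hx hy =>
    obtain ⟨m, hm⟩ := hx
    obtain ⟨n, hn⟩ := hy
    exact ⟨m + n, mul_mem_wordBall hm hn⟩
  | inv x _ hx =>
    obtain ⟨n, hn⟩ := hx
    exact ⟨n, inv_mem_wordBall hn⟩

theorem exists_forall_mem_wordBall (hS : Subgroup.closure S = ⊤) {ι : Type*} [Finite ι]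
    (f : ι → G) : ∃ n, ∀ i, f i ∈ wordBall S n := by
  choose n hn using fun i => exists_mem_wordBall hS (f i)
  obtain ⟨N, hN⟩ := Finite.exists_le n
  exact ⟨N, fun i => wordBall_mono (hN i) (hn i)⟩

theorem map_mem_wordBall {K : Type*} [Group K] {T : Set K} (f : G →* K) {k : ℕ}
    (hf : ∀ s ∈ S, f s ∈ wordBall T k) {n : ℕ} {g : G} (hg : g ∈ wordBall S n) :
    f g ∈ wordBall T (k * n) := by
  obtain ⟨l, hl, hS, rfl⟩ := hg
  refine wordBall_mono (Nat.mul_le_mul_left k hl) ?_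
  clear hl
  induction l with
  | nil => simpa using one_mem_wordBall 0
  | cons a l ih =>
    rw [List.prod_cons, map_mul, List.length_cons, Nat.mul_add, mul_one, add_comm]
    refine mul_mem_wordBall ?_ (ih fun x hx => hS x (List.mem_cons_of_mem _ hx))
    rcases hS a List.mem_cons_self with h | h
    · exact hf a h
    · simpa using inv_mem_wordBall (hf _ h)

theorem exists_map_mem_wordBall {K : Type*} [Group K] {T : Set K} (hT : Subgroup.closure T = ⊤)
    (hS : S.Finite) (f : G →* K) :
    ∃ k, ∀ n, ∀ g ∈ wordBall S n, f g ∈ wordBall T (k * n) := by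
  have : Finite S := hS
  obtain ⟨k, hk⟩ := exists_forall_mem_wordBall hT (fun s : S => f s)
  exact ⟨k, fun n g hg => map_mem_wordBall f (fun s hs => hk ⟨s, hs⟩) hg⟩

end WordBall

/-! ### Distortion of a normal subgroup in a group generated by finitely many subgroups -/

section Distortion

variable {G : Type*} [Group G] {H : Subgroup G}

/-- If `L` has finite index modulo `H`, then a word of length `n` is, modulo `H` and up to
finitely many left factors, equal to a word of length `n` in `L`. -/
theorem exists_finite_representatives [H.Normal] {L : Subgroup G} (hL : (L ⊔ H).FiniteIndex)
    {S : Set G} (hS : S.Finite) :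
    ∃ C : Set G, C.Finite ∧ ∃ X : Set L, X.Finite ∧ ∀ n, ∀ g ∈ wordBall S n,
      ∃ c ∈ C, ∃ a ∈ wordBall X n, g * (c * a)⁻¹ ∈ H := by
  have hfin : Finite (G ⧸ (L ⊔ H)) := inferInstance
  set C : Set G := insert 1 (Set.range fun q : G ⧸ (L ⊔ H) => q.out)
  have hC : C.Finite := (Set.finite_range _).insert 1
  have hrep : ∀ g : G, ∃ c ∈ C, ∃ a : L, g * (c * a)⁻¹ ∈ H := by
    intro g
    have h1 : (g : G ⧸ (L ⊔ H)).out⁻¹ * g ∈ L ⊔ H := QuotientGroup.eq.1 (by simp)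
    obtain ⟨a, ha, h, hh, hah⟩ := Subgroup.mem_sup_of_normal_right.1 h1
    refine ⟨_, Or.inr ⟨(g : G ⧸ (L ⊔ H)), rfl⟩, ⟨a, ha⟩, ?_⟩
    have h2 : g = (g : G ⧸ (L ⊔ H)).out * (a * h) := by rw [hah]; group
    have h3 : g * ((g : G ⧸ (L ⊔ H)).out * a)⁻¹ =
        ((g : G ⧸ (L ⊔ H)).out * a) * h * ((g : G ⧸ (L ⊔ H)).out * a)⁻¹ := by
      nth_rw 1 [h2]
      group
    exact h3 ▸ ‹H.Normal›.conj_mem h hh _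
  choose r hrC a hra using hrep
  set S' : Set G := S ∪ S⁻¹
  have hS' : S'.Finite := hS.union hS.inv
  -- Rewriting from right to left: modulo `H`, a letter `s` passes a representative `c` by `s * c ≡
  -- r (s * c) * a (s * c)`, so each letter of the word produces one letter from this finite set.
  refine ⟨C, hC, (fun p : G × G => a (p.1 * p.2)) '' (S' ×ˢ C), (hS'.prod hC).image _, ?_⟩
  rintro n g ⟨l, hl, hlS, rfl⟩
  suffices h : ∃ c ∈ C, ∃ b ∈ wordBall ((fun p : G × G => a (p.1 * p.2)) '' (S' ×ˢ C)) l.length,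
      l.prod * (c * b)⁻¹ ∈ H by
    obtain ⟨c, hc, b, hb, hH⟩ := h
    exact ⟨c, hc, b, wordBall_mono hl hb, hH⟩
  clear hl
  induction l with
  | nil => exact ⟨1, Or.inl rfl, 1, one_mem_wordBall 0, by simp⟩
  | cons s l ih =>
    obtain ⟨c, hc, b, hb, hH⟩ := ih fun x hx => hlS x (List.mem_cons_of_mem _ hx)
    have hs : s ∈ S' := by simpa [S'] using hlS s List.mem_cons_self
    refine ⟨r (s * c), hrC _, a (s * c) * b, ?_, ?_⟩
    · rw [List.length_cons, add_comm]
      exact mul_mem_wordBall (mem_wordBall_one (Or.inl ⟨(s, c), ⟨hs, hc⟩, rfl⟩)) hb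
    · have h1 : (s :: l).prod * (r (s * c) * ↑(a (s * c) * b))⁻¹ =
          (s * (l.prod * (c * b)⁻¹) * s⁻¹) * (s * c * (r (s * c) * a (s * c))⁻¹) := by
        rw [List.prod_cons, Subgroup.coe_mul]
        group
      rw [h1]
      exact mul_mem (‹H.Normal›.conj_mem _ hH s) (hra _)

/-- Elements `c * α * c'⁻¹` of `H` with `α` in a ball of `A` and `c`, `c'` in a finite set are
bounded in terms of the distortion of `A ∩ H` in `A`. -/
theorem exists_conj_mem_wordBall [H.Normal] {T : Set H} (hT : Subgroup.closure T = ⊤)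
    {A : Subgroup G} {SA : Set A} (hSA : Subgroup.closure SA = ⊤)
    {TA : Set (H.subgroupOf A)} (hTA : TA.Finite) {C : Set G} (hC : C.Finite) :
    ∃ K : ℕ, ∀ N d : ℕ,
      (∀ β : H.subgroupOf A, (β : A) ∈ wordBall SA (N + K) → β ∈ wordBall TA d) →
      ∀ c ∈ C, ∀ c' ∈ C, ∀ α ∈ wordBall SA N, ∀ h : c * (α : G) * c'⁻¹ ∈ H,
        (⟨_, h⟩ : H) ∈ wordBall T (K * (d + 1)) := by
  classical
  have : Finite C := hC
  -- Fix one solution `δ` for each pair `(c, c')` that has any. Then `c * α * c'⁻¹` is the conjugate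
  -- by `c` of `α * δ⁻¹ ∈ A ∩ H`, times one of finitely many elements `c * δ * c'⁻¹`.
  let J := {p : C × C // ∃ α : A, (p.1 : G) * α * (p.2 : G)⁻¹ ∈ H}
  choose δ hδ using fun p : J => p.2
  obtain ⟨K₁, hK₁⟩ := exists_forall_mem_wordBall hSA δ
  obtain ⟨K₃, hK₃⟩ := exists_forall_mem_wordBall hT (fun p : J => (⟨_, hδ p⟩ : H))
  let conj : C → H.subgroupOf A →* H := fun c =>
    ((MulAut.conj (c : G)).toMonoidHom.comp (A.subtype.comp (H.subgroupOf A).subtype)).codRestrict H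
      (fun β => ‹H.Normal›.conj_mem _ β.2 _)
  choose k hk using fun c : C => exists_map_mem_wordBall hT hTA (conj c)
  obtain ⟨K₂, hK₂⟩ := Finite.exists_le k
  refine ⟨K₁ + K₂ + K₃, fun N d hd c hc c' hc' α hα h => ?_⟩
  let p : J := ⟨(⟨c, hc⟩, ⟨c', hc'⟩), α, h⟩
  have hβ : α * (δ p)⁻¹ ∈ H.subgroupOf A := by
    have h1 := mul_mem h (inv_mem (hδ p))
    have h2 := ‹H.Normal›.conj_mem _ h1 c⁻¹
    refine Subgroup.mem_subgroupOf.2 ?_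
    convert h2 using 1
    simp only [p, Subgroup.coe_mul, Subgroup.coe_inv]
    group
  have h1 := hd ⟨_, hβ⟩ (wordBall_mono (by omega)
    (mul_mem_wordBall hα (inv_mem_wordBall (hK₁ p))))
  have h2 := mul_mem_wordBall (hk ⟨c, hc⟩ d _ h1) (hK₃ p)
  have h3 : (⟨_, h⟩ : H) = conj ⟨c, hc⟩ ⟨_, hβ⟩ * ⟨_, hδ p⟩ := by
    refine Subtype.ext ?_
    change c * α * c'⁻¹ = c * (α * (δ p : G)⁻¹) * c⁻¹ * (c * δ p * c'⁻¹)
    group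
  rw [h3]
  refine wordBall_mono ?_ h2
  have := Nat.mul_le_mul_right d (hK₂ ⟨c, hc⟩)
  nlinarith

end Distortion

/-! ### Approximating prefixes of a word by elements of `H`. -/

section Distortion

variable {G : Type*} [Group G] {H : Subgroup G} {ι : Type*}

/-- Two subgroups of a family are linked modulo `H` if a common subgroup has finite index
modulo `H`. -/
def LinkedModulo (H : Subgroup G) (A : ι → Subgroup G) (i j : ι) : Prop :=
  ∃ L : Subgroup G, L ≤ A i ∧ L ≤ A j ∧ (L ⊔ H).FiniteIndex

/-- The element `k` of `H` is a left factor of `g` such that the right factor is short in `A`, up to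
an element of the finite set `C`. -/
def IsApprox (H : Subgroup G) (C : Set G) (A : Subgroup G) (SA : Set A) (N : ℕ) (g : G) (k : H) :
    Prop :=
  ∃ c ∈ C, ∃ α ∈ wordBall SA N, g = k * c * α

theorem IsApprox.mono {C C' : Set G} (hC : C ⊆ C') {A : Subgroup G} {SA : Set A} {N N' : ℕ}
    (hN : N ≤ N') {g : G} {k : H} (h : IsApprox H C A SA N g k) : IsApprox H C' A SA N' g k := by
  obtain ⟨c, hc, α, hα, hg⟩ := h
  exact ⟨c, hC hc, α, wordBall_mono hN hα, hg⟩

/-- One `k` serves both subgroups because the representative of `g` modulo `H` is a word in the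
common subgroup `L`, and both inclusions of `L` stretch lengths linearly. -/
theorem LinkedModulo.exists_isApprox [H.Normal] {A : ι → Subgroup G} {i j : ι}
    (h : LinkedModulo H A i j) {S : Set G} (hS : S.Finite) {SA : ∀ i, Set (A i)}
    (hSA : ∀ i, Subgroup.closure (SA i) = ⊤) :
    ∃ C : Set G, C.Finite ∧ ∃ K : ℕ, ∀ n, ∀ g ∈ wordBall S n,
      ∃ k : H, IsApprox H C (A i) (SA i) (K * n) g k ∧ IsApprox H C (A j) (SA j) (K * n) g k := by
  obtain ⟨L, hLi, hLj, hL⟩ := h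
  obtain ⟨C, hC, X, hX, hrep⟩ := exists_finite_representatives (H := H) hL hS
  obtain ⟨Ki, hKi⟩ := exists_map_mem_wordBall (hSA i) hX (Subgroup.inclusion hLi)
  obtain ⟨Kj, hKj⟩ := exists_map_mem_wordBall (hSA j) hX (Subgroup.inclusion hLj)
  refine ⟨C, hC, Ki + Kj, fun n g hg => ?_⟩
  obtain ⟨c, hc, a, ha, hH⟩ := hrep n g hg
  have hga : g = g * (c * a)⁻¹ * c * a := by group
  exact ⟨⟨_, hH⟩, ⟨c, hc, _, wordBall_mono (Nat.mul_le_mul_right n (by omega)) (hKi n a ha), hga⟩,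
    ⟨c, hc, _, wordBall_mono (Nat.mul_le_mul_right n (by omega)) (hKj n a ha), hga⟩⟩

/-- Approximations with respect to different subgroups of the family are close to each other. -/
theorem exists_forall_near_of_connected {K : Type*} [Group K] {T : Set K} {r : ι → ι → Prop}
    {i j : ι} (hij : Relation.ReflTransGen r i j) :
    ∃ m : ℕ, ∀ (near : ι → K → Prop) (M : ℕ),
      (∀ i k k', near i k → near i k' → k⁻¹ * k' ∈ wordBall T M) →
      (∀ i j, r i j → ∃ k, near i k ∧ near j k) →
      ∀ k k', near i k → near j k' → k⁻¹ * k' ∈ wordBall T (m * M) := by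
  induction hij with
  | refl => exact ⟨1, fun near M h _ k k' hk hk' => by simpa using h i k k' hk hk'⟩
  | @tail x y _ hxy ih =>
    obtain ⟨m, hm⟩ := ih
    refine ⟨m + 1, fun near M h hr k k' hk hk' => ?_⟩
    obtain ⟨z, hzx, hzy⟩ := hr x y hxy
    have h1 := mul_mem_wordBall (hm near M h hr k z hk hzx) (h y z k' hzy hk')
    rw [add_mul, one_mul]
    convert h1 using 1
    group

/-- For a letter in `A i`, pass from the base index `r` to `i`, make the step there, and return to
`r`. With `M = KA * (d + 1)` this costs `m * M + M + m * M`, whence the factor `2 * m + 1`. -/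
theorem exists_word_bound [H.Normal] [Finite ι] [Nonempty ι] {A : ι → Subgroup G}
    (hlink : ∀ i, LinkedModulo H A i i)
    (hconn : ∀ i j, Relation.ReflTransGen (LinkedModulo H A) i j)
    {SA : ∀ i, Set (A i)} (hSAfin : ∀ i, (SA i).Finite)
    (hSA : ∀ i, Subgroup.closure (SA i) = ⊤)
    {TA : ∀ i, Set (H.subgroupOf (A i))} (hTA : ∀ i, (TA i).Finite)
    {T : Set H} (hT : Subgroup.closure T = ⊤) :
    ∃ K : ℕ, ∀ n d : ℕ,
      (∀ i, ∀ β : H.subgroupOf (A i), (β : A i) ∈ wordBall (SA i) (K * (n + 1)) →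
        β ∈ wordBall (TA i) d) →
      ∀ h : H, (h : G) ∈ wordBall (⋃ i, (A i).subtype '' SA i) n →
        h ∈ wordBall T (K * (n + 1) * (d + 1)) := by
  set U : Set G := ⋃ i, (A i).subtype '' SA i
  have hU : U.Finite := Set.finite_iUnion fun i => (hSAfin i).image _
  let J := {p : ι × ι // LinkedModulo H A p.1 p.2}
  choose C₁ hC₁ K₁ hCK using fun p : J => p.2.exists_isApprox hU hSA
  set C : Set G := insert 1 (⋃ p, C₁ p)
  have hC : C.Finite := (Set.finite_iUnion hC₁).insert 1
  obtain ⟨K₀, hK₀⟩ := Finite.exists_le K₁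
  choose K₂ hK₂ using fun i => exists_conj_mem_wordBall hT (hSA i) (hTA i) hC
  obtain ⟨KA, hKA⟩ := Finite.exists_le K₂
  -- The chain constants are fixed before `n`, `d` and the prefix `g`, so a single `m` serves all of
  -- them.
  choose m₁ hm₁ using fun p : ι × ι =>
    exists_forall_near_of_connected (T := T) (hconn p.1 p.2)
  obtain ⟨m, hm⟩ := Finite.exists_le m₁
  obtain ⟨r⟩ := ‹Nonempty ι›
  -- The first three summands cover the radius `2 * K₀ * n + 1 + KA` needed in the `A i`; the last
  -- one covers the total cost of the walk.
  refine ⟨2 * K₀ + KA + 1 + (2 * m + 1) * KA, fun n d hd h hh => ?_⟩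
  let near : G → ι → H → Prop := fun g i k => IsApprox H C (A i) (SA i) (K₀ * n) g k
  set M := KA * (d + 1)
  have hstep : ∀ (g : G) (i : ι) (s : A i), s ∈ wordBall (SA i) 1 → ∀ k k', near g i k →
      near (g * s) i k' → k⁻¹ * k' ∈ wordBall T M := by
    rintro g i s hs k k' ⟨c, hc, α, hα, hg⟩ ⟨c', hc', α', hα', hg'⟩
    have h1 := mul_mem_wordBall (mul_mem_wordBall hα hs) (inv_mem_wordBall hα')
    have h2 : (k : G)⁻¹ * k' = c * (α * s * α'⁻¹ : A i) * c'⁻¹ := by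
      have h3 : (k' : G) = g * s * (α' : G)⁻¹ * c'⁻¹ := by rw [hg']; group
      rw [h3, hg, Subgroup.coe_mul, Subgroup.coe_mul, Subgroup.coe_inv]
      group
    have h4 : c * (α * s * α'⁻¹ : A i) * c'⁻¹ ∈ H := by
      rw [← h2]
      exact mul_mem (inv_mem k.2) k'.2
    have h5 := hK₂ i (K₀ * n + 1 + K₀ * n) d (fun β hβ => hd i β (wordBall_mono ?_ hβ))
      c hc c' hc' _ h1 h4
    · have h6 : k⁻¹ * k' = ⟨_, h4⟩ := Subtype.ext h2
      rw [h6]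
      exact wordBall_mono (Nat.mul_le_mul_right _ (hKA i)) h5
    · have := hKA i
      nlinarith [Nat.zero_le (KA * n), Nat.zero_le ((2 * m + 1) * KA * (n + 1))]
  have hgate : ∀ g ∈ wordBall U n, ∀ i j, LinkedModulo H A i j →
      ∃ k, near g i k ∧ near g j k := by
    intro g hg i j hij
    obtain ⟨k, hki, hkj⟩ := hCK ⟨(i, j), hij⟩ n g hg
    have hCs : C₁ ⟨(i, j), hij⟩ ⊆ C := (Set.subset_iUnion C₁ _).trans (Set.subset_insert _ _)
    have hKs := Nat.mul_le_mul_right n (hK₀ ⟨(i, j), hij⟩)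
    exact ⟨k, hki.mono hCs hKs, hkj.mono hCs hKs⟩
  have hclose : ∀ g ∈ wordBall U n, ∀ i j k k', near g i k → near g j k' →
      k⁻¹ * k' ∈ wordBall T (m * M) := by
    intro g hg i j k k' hk hk'
    refine wordBall_mono (Nat.mul_le_mul_right M (hm (i, j)))
      (hm₁ (i, j) (near g) M (fun i k k' hk hk' => ?_) (hgate g hg) k k' hk hk')
    -- The trivial step `s = 1` compares two approximations of the same element.
    exact hstep g i 1 (one_mem_wordBall 1) k k' hk (by simpa using hk')
  have hwalk : ∀ l : List G, l.length ≤ n → (∀ x ∈ l, x ∈ U ∨ x⁻¹ ∈ U) → ∀ k, near l.prod r k →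
      k ∈ wordBall T (m * M + (2 * m + 1) * M * l.length) := by
    intro l
    induction l using List.reverseRecOn with
    | nil =>
      intro _ _ k hk
      have h1 : near 1 r 1 := ⟨1, Or.inl rfl, 1, one_mem_wordBall _, by simp⟩
      simpa using hclose 1 (one_mem_wordBall n) r r 1 k h1 hk
    | append_singleton l s ih =>
      intro hl hlU k hk
      rw [List.length_append, List.length_singleton] at hl
      have hl' : ∀ x ∈ l, x ∈ U ∨ x⁻¹ ∈ U := fun x hx => hlU x (List.mem_append_left _ hx)
      obtain ⟨i, s, rfl, hs⟩ : ∃ i, ∃ s' : A i, (s' : G) = s ∧ s' ∈ wordBall (SA i) 1 := by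
        rcases hlU s (by simp) with h | h
        · obtain ⟨i, s', hs', rfl⟩ := Set.mem_iUnion.1 h
          exact ⟨i, s', rfl, mem_wordBall_one (Or.inl hs')⟩
        · obtain ⟨i, s', hs', heq⟩ := Set.mem_iUnion.1 h
          refine ⟨i, s'⁻¹, ?_, mem_wordBall_one (Or.inr (by rwa [inv_inv]))⟩
          rw [Subgroup.coe_inv, show (s' : G) = s⁻¹ from heq, inv_inv]
      have hg : l.prod ∈ wordBall U n := ⟨l, by omega, hl', rfl⟩
      have hgs : (l ++ [(s : G)]).prod ∈ wordBall U n :=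
        ⟨_, by rw [List.length_append, List.length_singleton]; exact hl, hlU, rfl⟩
      obtain ⟨k₀, hk₀, -⟩ := hgate _ hg r r (hlink r)
      obtain ⟨k₁, hk₁, -⟩ := hgate _ hg i i (hlink i)
      obtain ⟨k₂, hk₂, -⟩ := hgate _ hgs i i (hlink i)
      have e0 := ih (by omega) hl' k₀ hk₀
      have e1 := hclose _ hg r i k₀ k₁ hk₀ hk₁
      have e2 := hstep l.prod i s hs k₁ k₂ hk₁ (by simpa using hk₂)
      have e3 := hclose _ hgs i r k₂ k hk₂ hk
      have e := mul_mem_wordBall (mul_mem_wordBall (mul_mem_wordBall e0 e1) e2) e3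
      have hk' : k₀ * (k₀⁻¹ * k₁) * (k₁⁻¹ * k₂) * (k₂⁻¹ * k) = k := by group
      rw [hk'] at e
      refine wordBall_mono (le_of_eq ?_) e
      rw [List.length_append, List.length_singleton]
      ring
  obtain ⟨l, hl, hlU, hlh⟩ := hh
  -- An element of `H` approximates itself, with `c = 1` and `α = 1`.
  have h1 : near l.prod r h := ⟨1, Or.inl rfl, 1, one_mem_wordBall _, by simp [hlh]⟩
  refine wordBall_mono ?_ (hwalk l hl hlU h h1)
  calc m * M + (2 * m + 1) * M * l.length ≤ (2 * m + 1) * M + (2 * m + 1) * M * n := by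
        gcongr
        omega
    _ = (2 * m + 1) * KA * (n + 1) * (d + 1) := by ring
    _ ≤ _ := by
        gcongr
        omega

end Distortion

/-! ### From bounds on balls to domination of distortion functions. -/

theorem wordLength_le_floor {G : Type*} [Group G] {S : Set G} {g : G} {x : ℝ≥0}
    (h : (wordLength S g : ℝ≥0∞) ≤ (x : ℝ≥0∞)) : g ∈ wordBall S ⌊x⌋₊ := by
  have hne : wordLength S g ≠ ⊤ := by
    intro htop
    rw [htop] at h
    exact absurd h (by simp)
  obtain ⟨m, hm⟩ := ENat.ne_top_iff_exists.1 hne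
  rw [← hm] at h
  refine wordLength_le_iff.1 ?_
  rw [← hm]
  refine Nat.cast_le.2 (Nat.le_floor (ENNReal.coe_le_coe.1 ?_))
  simpa using h

theorem le_distortion {G : Type*} [Group G] {S : Set G} {H : Subgroup G} {T : Set H} {r : ℝ≥0}
    {h : H} {n : ℕ} (hn : (h : G) ∈ wordBall S n) (hr : (n : ℝ≥0) ≤ r) :
    (wordLength T h : ℝ≥0∞) ≤ distortion S H T r := by
  refine le_iSup₂_of_le h ?_ le_rfl
  calc (wordLength S (h : G) : ℝ≥0∞) ≤ ((n : ℕ∞) : ℝ≥0∞) :=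
        ENat.toENNReal_le.2 (wordLength_le_iff.2 hn)
    _ = ((n : ℝ≥0) : ℝ≥0∞) := by simp
    _ ≤ r := by exact_mod_cast hr

/-- A bound on word lengths in terms of balls gives domination of the distortion functions. -/
theorem dominated_of_forall_wordBall {G : Type*} [Group G] {H : Subgroup G} {S : Set G} {T : Set H}
    {ι : Type*} {A : ι → Subgroup G} {SA : ∀ i, Set (A i)} {TA : ∀ i, Set (H.subgroupOf (A i))}
    {K : ℕ} (hK : ∀ n d : ℕ,
      (∀ i, ∀ β : H.subgroupOf (A i), (β : A i) ∈ wordBall (SA i) (K * (n + 1)) →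
        β ∈ wordBall (TA i) d) →
      ∀ h : H, (h : G) ∈ wordBall S n → h ∈ wordBall T (K * (n + 1) * (d + 1))) :
    Dominated (distortion S H T)
      (fun n : ℝ≥0 => (n : ℝ≥0∞) * ⨆ i, distortion (SA i) (H.subgroupOf (A i)) (TA i) n) := by
  -- For `x > 1` one has `⌊x⌋₊ + 1 ≤ 2 * x`, so `K * (n + 1) ≤ B * x`. The `+ 1` in `d + 1` becomes
  -- the linear term `B * x`.
  set B : ℝ≥0 := 2 * (K + 1)
  have hB : 0 < B := by positivity
  refine ⟨1, B, B, 1, one_pos, hB, hB, one_pos, fun x hx => ?_⟩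
  set D : ℝ≥0∞ := ⨆ i, distortion (SA i) (H.subgroupOf (A i)) (TA i) (B * x) with hD
  have hx0 : 0 < x := one_pos.trans hx
  rcases eq_or_ne D ⊤ with htop | htop
  · simp only [← hD, htop]
    rw [ENNReal.mul_top (by exact_mod_cast (mul_pos hB hx0).ne')]
    simp
  set n := ⌊x⌋₊
  have hnx : (n : ℝ≥0) ≤ x := Nat.floor_le hx0.le
  have hr : ((K * (n + 1) : ℕ) : ℝ≥0) ≤ B * x := by
    push_cast
    calc (K : ℝ≥0) * (n + 1) ≤ (K + 1) * (x + x) := by gcongr; simp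
      _ = B * x := by simp only [B]; ring
  have hd : ∀ i, ∀ β : H.subgroupOf (A i), (β : A i) ∈ wordBall (SA i) (K * (n + 1)) →
      β ∈ wordBall (TA i) ⌊D.toNNReal⌋₊ := by
    intro i β hβ
    refine wordLength_le_floor ?_
    rw [ENNReal.coe_toNNReal htop]
    exact (le_distortion hβ hr).trans
      (le_iSup (fun i => distortion (SA i) (H.subgroupOf (A i)) (TA i) (B * x)) i)
  refine iSup₂_le fun h hh => ?_
  have h1 := wordLength_le_iff.2 (hK n _ hd h (wordLength_le_floor hh))
  set d := ⌊D.toNNReal⌋₊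
  have hdD : (d : ℝ≥0) ≤ D.toNNReal := Nat.floor_le zero_le
  calc (wordLength T h : ℝ≥0∞) ≤ ((K * (n + 1) * (d + 1) : ℕ) : ℝ≥0) := by
        simpa using ENat.toENNReal_le.2 h1
    _ ≤ ((B * x * (D.toNNReal + 1) : ℝ≥0) : ℝ≥0∞) := by
        rw [ENNReal.coe_le_coe, Nat.cast_mul]
        push_cast at hr ⊢
        gcongr
    _ = _ := by
        rw [mul_add, mul_one, ENNReal.coe_add, ENNReal.coe_mul _ D.toNNReal,
          ENNReal.coe_toNNReal htop]
        simp [← hD]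

/-- If subgroups `A i`, `i ∈ W`, generate a group and any two of them are joined by a chain of linked
ones, then the distortion of a normal subgroup is dominated by the distortions in the `A i`. -/
theorem dominated_of_linkedModulo {G : Type*} [Group G] {H : Subgroup G} [H.Normal] {ι : Type*}
    [Finite ι] {A : ι → Subgroup G} {W : Set ι} (hne : W.Nonempty) (hgen : ⨆ i ∈ W, A i = ⊤)
    (hlink : ∀ i : W, LinkedModulo H (fun i : W => A i) i i)
    (hconn : ∀ i j : W, Relation.ReflTransGen (LinkedModulo H (fun i : W => A i)) i j)
    {S : Set G} (hS : S.Finite) {T : Set H} (hT : Subgroup.closure T = ⊤)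
    {SA : ∀ i, Set (A i)} (hSAfin : ∀ i, (SA i).Finite)
    (hSA : ∀ i, Subgroup.closure (SA i) = ⊤)
    {TA : ∀ i, Set (H.subgroupOf (A i))} (hTA : ∀ i, (TA i).Finite) :
    Dominated (distortion S H T)
      (fun n : ℝ≥0 => (n : ℝ≥0∞) * ⨆ i, distortion (SA i) (H.subgroupOf (A i)) (TA i) n) := by
  have := hne.to_subtype
  obtain ⟨K, hK⟩ := exists_word_bound hlink hconn (SA := fun i : W => SA i)
    (fun i => hSAfin i) (fun i => hSA i) (TA := fun i : W => TA i) (fun i => hTA i) hT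
  have hU : Subgroup.closure (⋃ i : W, (A i).subtype '' SA i) = ⊤ := by
    rw [Subgroup.closure_iUnion, ← hgen, iSup_subtype]
    congr 1
    ext1 i
    congr 1
    ext1 hi
    rw [← MonoidHom.map_closure, hSA i, ← MonoidHom.range_eq_map, Subgroup.range_subtype]
  -- Replacing `S` by the union of the generating sets of the `A i` costs a linear factor `κ`.
  obtain ⟨κ, hκ⟩ := exists_map_mem_wordBall hU hS (MonoidHom.id _)
  refine dominated_of_forall_wordBall (K := K * (κ + 1)) fun n d hd h hh => ?_
  have hle : K * (κ * n + 1) ≤ K * (κ + 1) * (n + 1) := by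
    rw [mul_assoc]
    gcongr
    nlinarith
  exact wordBall_mono (Nat.mul_le_mul_right _ hle)
    (hK (κ * n) d (fun i β hβ => hd i β (wordBall_mono hle hβ)) h (hκ n _ hh))

/-! ### Conclusion for trees of groups. -/

namespace GraphOfGroups

variable {V : Type u} [Quiver.{v} V] (𝒢 : GraphOfGroups.{u, v, w} V)

theorem fg_fundamentalGroup [Finite V] (hfg : ∀ a : V, Group.FG (𝒢.vertexGroup a)) :
    Group.FG (𝒢.FundamentalGroup ⊤) := by
  choose X hX using fun a => (hfg a).out
  refine Group.fg_iff.2 ⟨⋃ a, 𝒢.vertexHom ⊤ a '' X a, ?_,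
    Set.finite_iUnion fun a => (X a).finite_toSet.image _⟩
  rw [Subgroup.closure_iUnion, ← 𝒢.iSup_vertexSubgroup]
  congr 1
  ext1 a
  rw [← MonoidHom.map_closure, hX a, vertexSubgroup, MonoidHom.range_eq_map]

variable {𝒢}

/-- Adjacent vertices are linked by their edge subgroup. A vertex is linked to itself through its
first neighbour in a chain, or, if `W` is a single vertex, because its vertex subgroup is the whole
group. -/
theorem IsConnectedGenerating.linkedModulo {W : Set V} (hW : 𝒢.IsConnectedGenerating W)
    {H : Subgroup (𝒢.FundamentalGroup ⊤)}
    (hfin : ∀ a ∈ W, ∀ b ∈ W, ∀ e : a ⟶ b, (𝒢.edgeSubgroup ⊤ e ⊔ H).FiniteIndex) :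
    (∀ a : W, LinkedModulo H (fun a : W => 𝒢.vertexSubgroup ⊤ a) a a) ∧
      ∀ a b : W, Relation.ReflTransGen
        (LinkedModulo H (fun a : W => 𝒢.vertexSubgroup ⊤ a)) a b := by
  have hadj : ∀ a b : W, QuiverAdj (a : V) b →
      LinkedModulo H (fun a : W => 𝒢.vertexSubgroup ⊤ a) a b := by
    rintro a b (⟨⟨e⟩⟩ | ⟨⟨e⟩⟩)
    · exact ⟨_, 𝒢.edgeSubgroup_le_source e, 𝒢.edgeSubgroup_le_target e, hfin a a.2 b b.2 e⟩
    · exact ⟨_, 𝒢.edgeSubgroup_le_target e, 𝒢.edgeSubgroup_le_source e, hfin b b.2 a a.2 e⟩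
  have hconn : ∀ a b : W, Relation.ReflTransGen
      (LinkedModulo H (fun a : W => 𝒢.vertexSubgroup ⊤ a)) a b := by
    rintro ⟨a, ha⟩ ⟨b, hb⟩
    have h := hW.reflTransGen a ha b hb
    induction h with
    | refl => exact .refl
    | tail _ hyz ih => exact (ih hyz.1).tail (hadj ⟨_, hyz.1⟩ ⟨_, hyz.2.1⟩ hyz.2.2)
  refine ⟨fun a => ?_, hconn⟩
  by_cases hsub : ∃ b, b ≠ a
  · obtain ⟨b, hb⟩ := hsub
    rcases (hconn a b).cases_head with h | ⟨c, ⟨L, hLa, -, hL⟩, -⟩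
    · exact absurd h.symm hb
    · exact ⟨L, hLa, hLa, hL⟩
  · push Not at hsub
    have htop : 𝒢.vertexSubgroup ⊤ (a : V) = ⊤ := by
      rw [eq_top_iff, ← hW.iSup_eq]
      exact iSup₂_le fun b hb => (hsub ⟨b, hb⟩) ▸ le_rfl
    exact ⟨⊤, htop.ge, htop.ge, by rw [top_sup_eq]; infer_instance⟩

end GraphOfGroups

/-- The underlying graph is simply connected, that is, a tree, so its maximal subtree is the whole
graph `⊤`, and `𝒢.FundamentalGroup ⊤` is the fundamental group of the graph of groups. -/
theorem mainTheorem8 {V : Type u} [Quiver.{v} V] [Finite V] [∀ a b : V, Finite (a ⟶ b)]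
    (hV : IsSimplyConnectedGraph V)
    (𝒢 : GraphOfGroups.{u, v, w} V) (hfg : ∀ a : V, Group.FG (𝒢.vertexGroup a))
    (H : Subgroup (𝒢.FundamentalGroup ⊤)) (hnormal : H.Normal) (hH : H.FG)
    (hedge : ∀ (a b : V) (e : a ⟶ b), ¬ H ≤ 𝒢.edgeSubgroup ⊤ e)
    (hvertex : ∀ a : V, (H.subgroupOf (𝒢.vertexSubgroup ⊤ a)).FG) :
    Group.FG (𝒢.FundamentalGroup ⊤) ∧
    ∀ (S : Finset (𝒢.FundamentalGroup ⊤)) (T : Finset H)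
      (SA : ∀ a : V, Finset (𝒢.vertexSubgroup ⊤ a))
      (TA : ∀ a : V, Finset (H.subgroupOf (𝒢.vertexSubgroup ⊤ a))),
      Subgroup.closure (S : Set (𝒢.FundamentalGroup ⊤)) = ⊤ →
      Subgroup.closure (T : Set H) = ⊤ →
      (∀ a : V, Subgroup.closure (SA a : Set (𝒢.vertexSubgroup ⊤ a)) = ⊤) →
      (∀ a : V, Subgroup.closure (TA a : Set (H.subgroupOf (𝒢.vertexSubgroup ⊤ a))) = ⊤) →
      Dominated (distortion (S : Set (𝒢.FundamentalGroup ⊤)) H (T : Set H))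
        (fun n : ℝ≥0 => (n : ℝ≥0∞) * ⨆ a : V,
          distortion (SA a : Set (𝒢.vertexSubgroup ⊤ a))
            (H.subgroupOf (𝒢.vertexSubgroup ⊤ a))
            (TA a : Set (H.subgroupOf (𝒢.vertexSubgroup ⊤ a))) n) := by
  refine ⟨𝒢.fg_fundamentalGroup hfg, fun S T SA TA _ hT hSA _ => ?_⟩
  obtain ⟨W, hW, hfin⟩ := 𝒢.exists_core hV hnormal hH hedge
  obtain ⟨hlink, hconn⟩ := hW.linkedModulo hfin
  exact dominated_of_linkedModulo hW.nonempty hW.iSup_eq hlink hconn S.finite_toSet hT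
    (fun a => (SA a).finite_toSet) hSA (fun a => (TA a).finite_toSet)
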